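/- Consider a network of finitely many fluid queues. Of the vehicles leaving queue $i$, a fraction $r(i,j)\ge 0$ travels to queue $j$, which it joins after a travel time $\tau(i,j)>0$, and the fraction $1-\sum_j r(i,j)\ge 0$ leaves the network. Queue $i$ receives external arrivals at rate $e(i)(t)\ge 0$ and has saturation flow (service rate) $c(i)(t)\ge 0$, $t\ge 0$; these functions are locally integrable and periodic with a common period $T>0$. Put $\bar\tau=\max_{i,j}\tau(i,j)$. A trajectory consists of queue lengths $x(i)(t)$, $t\ge 0$, and locally integrable departure rates $b(i)(t)$, $t\ge-\bar\tau$, with arbitrary initial data $x(i)(0)\ge 0$ and $b(i)(s)\ge 0$ for $s\in[-\bar\tau,0]$, such that for $t\ge 0$ $$\dot x(i)(t)=e(i)(t)+\sum_j b(j)(t-\tau(j,i))\,r(j,i)-b(i)(t)$$ (in integrated form) and, for almost every $t\ge0$, $b(i)(t)=c(i)(t)$ if $x(i)(t)>0$, $b(i)(t)\in[0,c(i)(t)]$ if $x(i)(t)=0$, and $b(i)(t)=0$ if $x(i)(t)<0$. Its state at time $t$ is the pair $(x(t),\beta(t))$, where $\beta(t)$ is the restriction of $b$ to $[t-\bar\tau,t]$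 (up to null sets). Let $R=(r(i,j))$, $\bar e(i)=\frac1T\int_0^T e(i)(t)\,dt$ and $\bar c(i)=\frac1T\int_0^T c(i)(t)\,dt$. Suppose that every vehicle leaves the network after visiting at most $K$ queues, that is, every sequence of queues $i_1,\dots,i_n$ with $r(i_k,i_{k+1})>0$ for $1\le k<n$ has $n\le K$ (so that $I-R^{T}$ is invertible, where $R^T$ is the transpose of $R$), and that the stability condition holds: for some $\epsilon>0$, componentwise, $\bar c>[I-R^{T}]^{-1}\bar e+\epsilon\mathbf 1$. Then there is a unique trajectory $(x^*,b^*)$ whose state is periodic with period $T$ (unique up to changing $b^*$ on a null set of times), and for every trajectory $(x,b)$ there is a finite time $t_0$ such that its state coincides with the state of $(x^*,b^*)$ at every time $t\ge t_0$. -/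

import Mathlib

open MeasureTheory Set

/-- Data of a network of fluid queues indexed by `ι`, at times `t ≥ 0` (values of `e` and `c` at
negative times are never used). -/
structure QueueNetwork (ι : Type*) [Fintype ι] where
  /-- `r i j` is the fraction of the vehicles leaving queue `i` that go to queue `j`;
  the remaining fraction `1 - ∑ j, r i j` leaves the network. -/
  r : ι → ι → ℝ
  /-- `τ i j` is the travel time from queue `i` to queue `j`. -/
  τ : ι → ι → ℝ
  /-- `e i t` is the rate of arrivals at queue `i` from outside the network. -/
  e : ι → ℝ → ℝ
  /-- `c i t` is the saturation flow (service rate) of queue `i`. -/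
  c : ι → ℝ → ℝ
  r_nonneg : ∀ i j, 0 ≤ r i j
  r_sum_le_one : ∀ i, ∑ j, r i j ≤ 1
  τ_pos : ∀ i j, 0 < τ i j
  e_nonneg : ∀ i t, 0 ≤ t → 0 ≤ e i t
  c_nonneg : ∀ i t, 0 ≤ t → 0 ≤ c i t
  e_integrable : ∀ i t, 0 ≤ t → IntegrableOn (e i) (Icc 0 t)
  c_integrable : ∀ i t, 0 ≤ t → IntegrableOn (c i) (Icc 0 t)

namespace QueueNetwork

variable {ι : Type*} [Fintype ι]

/-- The maximal travel time (`0` if there are no queues). -/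
noncomputable def maxDelay (N : QueueNetwork ι) : ℝ :=
  ⨆ p : ι × ι, N.τ p.1 p.2

/-- The total arrival rate `a(i)(t)` at queue `i`, given the departure rates `b`. -/
noncomputable def arrival (N : QueueNetwork ι) (b : ι → ℝ → ℝ) (i : ι) (t : ℝ) : ℝ :=
  N.e i t + ∑ j, b j (t - N.τ j i) * N.r j i

/-- `x` (queue lengths at times `t ≥ 0`) and `b` (departure rates at times `t ≥ -maxDelay`) form
a trajectory of the network, starting from an arbitrary initial condition: initial queue lengths
`x i 0 ≥ 0` and a past of departures `b i s ≥ 0` for `s ∈ [-maxDelay, 0]`.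
As usual, the differential equation is understood in integrated form, and the relations between
rates hold at almost every time. -/
structure IsTrajectory (N : QueueNetwork ι) (x b : ι → ℝ → ℝ) : Prop where
  init_nonneg : ∀ i, 0 ≤ x i 0
  past_nonneg : ∀ i, ∀ᵐ s, s ∈ Icc (-N.maxDelay) 0 → 0 ≤ b i s
  integrable : ∀ i t, 0 ≤ t → IntegrableOn (b i) (Icc (-N.maxDelay) t)
  balance : ∀ i t, 0 ≤ t → x i t = x i 0 + ∫ s in (0 : ℝ)..t, (N.arrival b i s - b i s)
  service : ∀ i, ∀ᵐ t, 0 ≤ t →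
    (0 < x i t → b i t = N.c i t) ∧
    (x i t = 0 → b i t ∈ Icc 0 (N.c i t)) ∧
    (x i t < 0 → b i t = 0)

/-- The state at time `t` consists of the queue lengths at time `t` and of the departure rates
on `[t - maxDelay, t]` (up to null sets of times). `(x, b)` and `(x', b')` have the same state
at time `t`. -/
def SameState (N : QueueNetwork ι) (x b x' b' : ι → ℝ → ℝ) (t : ℝ) : Prop :=
  ∀ i, x i t = x' i t ∧ ∀ᵐ s, s ∈ Icc (t - N.maxDelay) t → b i s = b' i s

/-- `(x, b)` is a trajectory whose state is periodic in time, with period `T`. -/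
def IsPeriodicTrajectory (N : QueueNetwork ι) (T : ℝ) (x b : ι → ℝ → ℝ) : Prop :=
  N.IsTrajectory x b ∧
    ∀ t, 0 ≤ t → N.SameState (fun i s => x i (s + T)) (fun i s => b i (s + T)) x b t

/-- External arrivals and saturation flows are periodic with period `T`. -/
def PeriodicData (N : QueueNetwork ι) (T : ℝ) : Prop :=
  ∀ i t, 0 ≤ t → N.e i (t + T) = N.e i t ∧ N.c i (t + T) = N.c i t

/-- The mean of `f` over one period `[0, T]`. -/
noncomputable def mean (T : ℝ) (f : ι → ℝ → ℝ) (i : ι) : ℝ :=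
  (1 / T) * ∫ t in (0 : ℝ)..T, f i t

/-- The routing matrix `R = (r i j)`. -/
def routing (N : QueueNetwork ι) : Matrix ι ι ℝ := Matrix.of N.r

/-- The stability condition `c̄ > (I - Rᵀ)⁻¹ ē + ε 𝟏` for some `ε > 0`. -/
def Stable [DecidableEq ι] (N : QueueNetwork ι) (T : ℝ) : Prop :=
  ∃ ε : ℝ, 0 < ε ∧
    ∀ i, ((1 - N.routing.transpose)⁻¹.mulVec (mean T N.e)) i + ε < mean T N.c i

/-- Every vehicle leaves after visiting at most `K` queues: every route, that is, every sequence
of queues in which each one sends a positive fraction of its departures to the next one, consists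
of at most `K` queues. -/
def VisitsAtMost (N : QueueNetwork ι) (K : ℕ) : Prop :=
  ∀ route : List ι, route.IsChain (fun i j => 0 < N.r i j) → route.length ≤ K

end QueueNetwork

/-! Bounded routes make the network acyclic, so everything can be done by well-founded induction
from feeders to fed queues.

Two copies of one queue with the same arrivals keep their order: where one is strictly longer it is
served at the full rate, so the gap cannot grow (`IsFluidQueue.le_of_le`). When the longer one
empties, so has the other, and they agree from then on (`IsFluidQueue.coalesce`). Queues do empty:
by induction, cumulative arrivals exceed the traffic-equation flow by at most a constant, and
stability puts mean service above that flow (`IsTrajectory.exists_length_eq_zero`). Hence any two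
trajectories eventually share their state (`IsTrajectory.exists_sameState`).

Some trajectory exists, by Skorokhod reflection at each queue (`exists_isTrajectory`). It eventually
agrees with its own shift by `T`; observed from a late multiple of `T` on, it is the periodic
trajectory. Uniqueness and finite-time convergence are again coalescence. -/

/-! ### Real-variable lemmas. -/

/-- A function that starts nonpositive and whose rate of change is nonpositive wherever it is
positive stays nonpositive. -/
lemma nonpos_of_rate_nonpos_of_pos {f g : ℝ → ℝ} {s t : ℝ} (hst : s ≤ t)
    (hg : IntervalIntegrable g volume s t)
    (hf : ∀ u ∈ Icc s t, f u = f s + ∫ v in s..u, g v)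
    (hrate : ∀ᵐ u, u ∈ Icc s t → 0 < f u → g u ≤ 0) (h0 : f s ≤ 0) : f t ≤ 0 := by
  by_contra! hpos
  have hgI : ∀ u ∈ Icc s t, IntervalIntegrable g volume s u := fun u hu =>
    hg.mono_set (by rw [uIcc_of_le hu.1, uIcc_of_le hst]; exact Icc_subset_Icc_right hu.2)
  have hcont : ContinuousOn f (Icc s t) := by
    have h : ContinuousOn (fun u => f s + ∫ v in s..u, g v) (Icc s t) :=
      continuousOn_const.add (by
        simpa [uIcc_of_le hst] using
          intervalIntegral.continuousOn_primitive_interval' hg left_mem_uIcc)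
    exact h.congr hf
  -- After the last time `m` with `f m ≤ 0`, `f` is positive, so its rate is nonpositive and `f t ≤
  -- f m`.
  set S := Icc s t ∩ f ⁻¹' Iic 0 with hS
  have hSc : IsCompact S :=
    isCompact_Icc.of_isClosed_subset (hcont.preimage_isClosed_of_isClosed isClosed_Icc isClosed_Iic)
      inter_subset_left
  obtain ⟨m, ⟨hmI, hm0⟩, hmax⟩ := hSc.exists_isGreatest ⟨s, left_mem_Icc.2 hst, h0⟩
  have hm0 : f m ≤ 0 := hm0
  have hdiff : f t - f m = ∫ v in m..t, g v := by
    rw [hf t (right_mem_Icc.2 hst), hf m hmI,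
      ← intervalIntegral.integral_interval_sub_left hg (hgI m hmI)]
    ring
  have hle : ∫ v in m..t, g v ≤ 0 := by
    rw [intervalIntegral.integral_of_le hmI.2]
    refine integral_nonpos_of_ae ?_
    rw [Filter.EventuallyLE, ae_restrict_iff' measurableSet_Ioc]
    filter_upwards [hrate] with u hu huI
    have huI' : u ∈ Icc s t := ⟨hmI.1.trans huI.1.le, huI.2⟩
    refine hu huI' ?_
    by_contra! h
    exact (hmax ⟨huI', h⟩).not_gt huI.1
  linarith

/-- If the integrals of `f` from `s` to every later time vanish, so does `f` almost everywhere
after `s`. -/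
lemma ae_eq_zero_of_forall_intervalIntegral_eq_zero {f : ℝ → ℝ} {s : ℝ}
    (hf : ∀ t, s ≤ t → IntervalIntegrable f volume s t)
    (h0 : ∀ t, s ≤ t → ∫ v in s..t, f v = 0) : ∀ᵐ t, s ≤ t → f t = 0 := by
  have key : ∀ n : ℕ, ∀ᵐ t, t ∈ Icc s (s + n) → f t = 0 := by
    intro n
    have hn : s ≤ s + n := by simp
    -- The endpoint is discarded because the primitive is only known to vanish to the right of `s`.
    have hs : ∀ᵐ t : ℝ, t ≠ s := by simp [ae_iff, measure_singleton]
    filter_upwards [(hf _ hn).ae_hasDerivAt_integral, hs] with t ht hts htI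
    have hlt : s < t := lt_of_le_of_ne htI.1 (Ne.symm hts)
    have h1 := ht (by rwa [uIcc_of_le hn]) s left_mem_uIcc
    have h2 : HasDerivAt (fun x => ∫ v in s..x, f v) 0 t := by
      refine (hasDerivAt_const t (0 : ℝ)).congr_of_eventuallyEq ?_
      filter_upwards [lt_mem_nhds hlt] with u hu using h0 u hu.le
    exact h1.unique h2
  filter_upwards [ae_all_iff.2 key] with t ht hst
  obtain ⟨n, hn⟩ := exists_nat_ge (t - s)
  exact ht n ⟨hst, by linarith⟩

/-- A function whose increments are dominated by those of an absolutely continuous function is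
absolutely continuous. -/
lemma AbsolutelyContinuousOnInterval.of_dist_le {f g : ℝ → ℝ} {a b : ℝ}
    (hg : AbsolutelyContinuousOnInterval g a b)
    (h : ∀ u ∈ uIcc a b, ∀ v ∈ uIcc a b, dist (f u) (f v) ≤ dist (g u) (g v)) :
    AbsolutelyContinuousOnInterval f a b := by
  refine squeeze_zero' (Filter.Eventually.of_forall fun E => Finset.sum_nonneg fun i _ =>
    dist_nonneg) ?_ hg
  refine Filter.mem_inf_of_right ?_
  intro E hE
  exact Finset.sum_le_sum fun i hi => h _ (hE.1 i hi).1 _ (hE.1 i hi).2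

/-! ### A single fluid queue: order preservation, coalescence, emptying. -/

/-- Queue lengths `x` and departure rates `b` of a single fluid queue, at times `t ≥ 0`, with
arrival rates `a` and saturation flow `c`. -/
structure IsFluidQueue (a c x b : ℝ → ℝ) : Prop where
  arrival_integrable : ∀ t, 0 ≤ t → IntervalIntegrable a volume 0 t
  departure_integrable : ∀ t, 0 ≤ t → IntervalIntegrable b volume 0 t
  balance : ∀ t, 0 ≤ t → x t = x 0 + ∫ s in (0 : ℝ)..t, (a s - b s)
  nonneg : ∀ t, 0 ≤ t → 0 ≤ x t
  service : ∀ᵐ t, 0 ≤ t → (0 < x t → b t = c t) ∧ b t ∈ Icc 0 (c t)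

namespace IsFluidQueue

variable {a a' c x x' b b' : ℝ → ℝ}

lemma intervalIntegrable_sub (h : IsFluidQueue a c x b) {s t : ℝ} (hs : 0 ≤ s) (ht : 0 ≤ t) :
    IntervalIntegrable (fun u => a u - b u) volume s t :=
  (((h.arrival_integrable s hs).sub (h.departure_integrable s hs)).symm).trans
    ((h.arrival_integrable t ht).sub (h.departure_integrable t ht))

lemma balance_from (h : IsFluidQueue a c x b) {s t : ℝ} (hs : 0 ≤ s) (ht : 0 ≤ t) :
    x t = x s + ∫ u in s..t, (a u - b u) := by
  rw [h.balance t ht, h.balance s hs, add_assoc, intervalIntegral.integral_add_adjacent_intervals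
    (h.intervalIntegrable_sub le_rfl hs) (h.intervalIntegrable_sub hs ht)]

/-- Queue lengths depend monotonically on the initial queue length. -/
lemma le_of_le (h : IsFluidQueue a c x b) (h' : IsFluidQueue a' c x' b') {s : ℝ} (hs : 0 ≤ s)
    (ha : ∀ᵐ t, s ≤ t → a t = a' t) (hx : x s ≤ x' s) {t : ℝ} (hst : s ≤ t) : x t ≤ x' t := by
  have hI : ∀ u, s ≤ u → IntervalIntegrable (fun u => (a u - b u) - (a' u - b' u)) volume s u :=
    fun u hu => (h.intervalIntegrable_sub hs (hs.trans hu)).sub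
      (h'.intervalIntegrable_sub hs (hs.trans hu))
  have key : x t - x' t ≤ 0 := by
    refine nonpos_of_rate_nonpos_of_pos (f := fun t => x t - x' t) hst (hI t hst) ?_ ?_
      (by linarith)
    · intro u hu
      have hu0 := hs.trans hu.1
      rw [intervalIntegral.integral_sub (h.intervalIntegrable_sub hs hu0)
        (h'.intervalIntegrable_sub hs hu0)]
      have := h.balance_from hs hu0
      have := h'.balance_from hs hu0
      linarith
    -- Where `x > x' ≥ 0`, the first queue departs at rate `c`, the second at most at `c`.
    · filter_upwards [ha, h.service, h'.service] with u hau hu hu' huI hpos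
      have hu0 := hs.trans huI.1
      have := h'.nonneg u hu0
      rw [hau huI.1, (hu hu0).1 (by linarith)]
      linarith [(hu' hu0).2.2]
  linarith

/-- Two queues with the same arrivals from time `s` on coalesce if each of them becomes empty at
some later time. -/
lemma coalesce (h : IsFluidQueue a c x b) (h' : IsFluidQueue a' c x' b') {s : ℝ} (hs : 0 ≤ s)
    (ha : ∀ᵐ t, s ≤ t → a t = a' t) (hx : ∃ t, s ≤ t ∧ x t = 0) (hx' : ∃ t, s ≤ t ∧ x' t = 0) :
    ∃ t₀, 0 ≤ t₀ ∧ (∀ t, t₀ ≤ t → x t = x' t) ∧ ∀ᵐ t, t₀ ≤ t → b t = b' t := by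
  have ha' : ∀ᵐ t, s ≤ t → a' t = a t := by
    filter_upwards [ha] with t ht hst using (ht hst).symm
  -- The queue that is longer at `s` stays the longer one; when it is empty, both are.
  obtain ⟨t₀, hst, heq⟩ : ∃ t₀, s ≤ t₀ ∧ x t₀ = x' t₀ := by
    rcases le_total (x s) (x' s) with hle | hle
    · obtain ⟨t, hst, h0⟩ := hx'
      exact ⟨t, hst, le_antisymm (h.le_of_le h' hs ha hle hst)
        (h0 ▸ h.nonneg t (hs.trans hst))⟩
    · obtain ⟨t, hst, h0⟩ := hx
      exact ⟨t, hst, le_antisymm (h0 ▸ h'.nonneg t (hs.trans hst))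
        (h'.le_of_le h hs ha' hle hst)⟩
  have ht0 := hs.trans hst
  have hxeq : ∀ t, t₀ ≤ t → x t = x' t := fun t ht => le_antisymm
    (h.le_of_le h' ht0 (ha.mono fun u hu huI => hu (hst.trans huI)) heq.le ht)
    (h'.le_of_le h ht0 (ha'.mono fun u hu huI => hu (hst.trans huI)) heq.ge ht)
  refine ⟨t₀, ht0, hxeq, ?_⟩
  have key := ae_eq_zero_of_forall_intervalIntegral_eq_zero
    (f := fun u => (a u - b u) - (a' u - b' u)) (s := t₀)
    (fun t ht => (h.intervalIntegrable_sub ht0 (ht0.trans ht)).sub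
      (h'.intervalIntegrable_sub ht0 (ht0.trans ht)))
    (fun t ht => by
      rw [intervalIntegral.integral_sub (h.intervalIntegrable_sub ht0 (ht0.trans ht))
        (h'.intervalIntegrable_sub ht0 (ht0.trans ht))]
      have := h.balance_from ht0 (ht0.trans ht)
      have := h'.balance_from ht0 (ht0.trans ht)
      have := hxeq t ht
      linarith)
  filter_upwards [key, ha] with t ht hat htt
  have := ht htt
  have := hat (hst.trans htt)
  linarith

/-- The total departures are bounded by the initial queue length and the total arrivals. -/
lemma integral_departure_le (h : IsFluidQueue a c x b) {t : ℝ} (ht : 0 ≤ t) :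
    ∫ s in (0 : ℝ)..t, b s ≤ x 0 + ∫ s in (0 : ℝ)..t, a s := by
  have h1 := h.balance t ht
  rw [intervalIntegral.integral_sub (h.arrival_integrable t ht) (h.departure_integrable t ht)] at h1
  linarith [h.nonneg t ht]

/-- A queue whose long-run arrival rate `lam` is less than the mean saturation flow `μ` becomes
empty again and again. -/
lemma exists_eq_zero (h : IsFluidQueue a c x b) {T lam μ C : ℝ} (hT : 0 < T)
    (hA : ∀ n : ℕ, ∫ s in (0 : ℝ)..n * T, a s ≤ n * T * lam + C)
    (hC : ∀ n : ℕ, ∫ s in (0 : ℝ)..n * T, c s = n * T * μ)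
    (hc : ∀ t, 0 ≤ t → IntervalIntegrable c volume 0 t) (hlt : lam < μ)
    {s : ℝ} (hs : 0 ≤ s) : ∃ t, s ≤ t ∧ x t = 0 := by
  by_contra! hne
  have hpos : ∀ t, s ≤ t → 0 < x t := fun t ht =>
    lt_of_le_of_ne (h.nonneg t (hs.trans ht)) (hne t ht).symm
  -- If `x` stayed positive after `s`, then `b = c` there, and `x (n * T)` would be at most `x s -
  -- ∫₀ˢ (a - c) + C - n * T * (μ - lam)`, which is negative for this `n`.
  obtain ⟨n, hn⟩ := exists_nat_gt
    (max (s / T) ((x s - (∫ u in (0 : ℝ)..s, (a u - c u)) + C) / (T * (μ - lam))))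
  have hn1 : s < n * T := (div_lt_iff₀ hT).1 (lt_of_le_of_lt (le_max_left _ _) hn)
  have hn2 := (div_lt_iff₀ (mul_pos hT (sub_pos.2 hlt))).1 (lt_of_le_of_lt (le_max_right _ _) hn)
  have hn0 : 0 ≤ n * T := hs.trans hn1.le
  have hI : ∀ t, 0 ≤ t → IntervalIntegrable (fun u => a u - c u) volume 0 t := fun t ht =>
    (h.arrival_integrable t ht).sub (hc t ht)
  have h1 : x (n * T) = x s + ∫ u in s..n * T, (a u - c u) := by
    rw [h.balance_from hs hn0]
    congr 1
    refine intervalIntegral.integral_congr_ae ?_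
    filter_upwards [h.service] with u hu huI
    rw [uIoc_of_le hn1.le] at huI
    rw [(hu (hs.trans huI.1.le)).1 (hpos u huI.1.le)]
  have h2 := intervalIntegral.integral_interval_sub_left (hI _ hn0) (hI _ hs)
  rw [intervalIntegral.integral_sub (h.arrival_integrable _ hn0) (hc _ hn0), hC n] at h2
  have := hA n
  have := hpos _ hn1.le
  nlinarith

/-! ### Construction of a queue by Skorokhod reflection. -/

/-- Every fluid queue with given arrivals, initially empty, has a solution. -/
theorem exists_of_arrival (ha : ∀ t, 0 ≤ t → IntervalIntegrable a volume 0 t)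
    (hc : ∀ t, 0 ≤ t → IntervalIntegrable c volume 0 t)
    (ha0 : ∀ᵐ t, 0 ≤ t → 0 ≤ a t) (hc0 : ∀ t, 0 ≤ t → 0 ≤ c t) :
    ∃ x b : ℝ → ℝ, IsFluidQueue a c x b ∧ ∀ t < 0, b t = 0 := by
  set A : ℝ → ℝ := fun t => ∫ s in (0 : ℝ)..t, a s with hAdef
  set C : ℝ → ℝ := fun t => ∫ s in (0 : ℝ)..t, c s with hCdef
  have hmono : ∀ f : ℝ → ℝ, (∀ t, 0 ≤ t → IntervalIntegrable f volume 0 t) →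
      (∀ᵐ t, 0 ≤ t → 0 ≤ f t) → ∀ u v, 0 ≤ u → u ≤ v →
      ∫ s in (0 : ℝ)..u, f s ≤ ∫ s in (0 : ℝ)..v, f s := by
    intro f hf hf0 u v hu huv
    refine intervalIntegral.integral_mono_interval le_rfl hu huv ?_ (hf v (hu.trans huv))
    rw [Filter.EventuallyLE, ae_restrict_iff' measurableSet_Ioc]
    filter_upwards [hf0] with t ht htI using ht htI.1.le
  have hAm := hmono a ha ha0
  have hCm := hmono c hc (Filter.Eventually.of_forall hc0)
  set w : ℝ → ℝ := fun t => C t - A t with hw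
  have hw0 : w 0 = 0 := by simp [hw, hAdef, hCdef]
  have hwc : ∀ t, 0 ≤ t → ContinuousOn w (Icc 0 t) := by
    intro t ht
    have h1 := intervalIntegral.continuousOn_primitive_interval' (hc t ht) left_mem_uIcc
    have h2 := intervalIntegral.continuousOn_primitive_interval' (ha t ht) left_mem_uIcc
    rw [uIcc_of_le ht] at h1 h2
    exact h1.sub h2
  -- The running maximum of potential service minus arrivals is the cumulative unused service: the
  -- solution is `x = L - w`, `b = c - L'`.
  set L : ℝ → ℝ := fun t => sSup (w '' Icc 0 t) with hL
  have hLmax : ∀ t, 0 ≤ t → ∃ s ∈ Icc 0 t, L t = w s := by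
    intro t ht
    obtain ⟨s, hs, h⟩ := isCompact_Icc.exists_sSup_image_eq (nonempty_Icc.2 ht) (hwc t ht)
    exact ⟨s, hs, h⟩
  have hLle : ∀ t, ∀ s ∈ Icc 0 t, w s ≤ L t := fun t s hs =>
    (hwc t (hs.1.trans hs.2)).le_sSup_image_Icc hs
  have hL0 : L 0 = 0 := by simp [hL, hw0]
  have hLmono : ∀ u v, 0 ≤ u → u ≤ v → L u ≤ L v := by
    intro u v hu huv
    obtain ⟨s, hs, h⟩ := hLmax u hu
    exact h ▸ hLle v s ⟨hs.1, hs.2.trans huv⟩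
  -- Arrivals only lower `w`, so `L` grows no faster than `C` and inherits its absolute continuity.
  have hLC : ∀ u v, 0 ≤ u → u ≤ v → L v - L u ≤ C v - C u := by
    intro u v hu huv
    obtain ⟨s, hs, h⟩ := hLmax v (hu.trans huv)
    rcases le_total s u with hsu | hus
    · linarith [hLle u s ⟨hs.1, hsu⟩, hCm u v hu huv]
    · have := hLle u u ⟨hu, le_rfl⟩
      have := hAm u s hu hus
      have := hCm s v hs.1 hs.2
      simp only [hw] at *
      linarith
  have hLac : ∀ t, 0 ≤ t → AbsolutelyContinuousOnInterval L 0 t := by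
    intro t ht
    refine ((hc t ht).absolutelyContinuousOnInterval_intervalIntegral left_mem_uIcc).of_dist_le ?_
    rw [uIcc_of_le ht]
    intro u hu v hv
    rcases le_total u v with h | h
    · rw [dist_comm, dist_comm (∫ v in (0 : ℝ)..u, c v), Real.dist_eq, Real.dist_eq,
        abs_of_nonneg (sub_nonneg.2 (hLmono u v hu.1 h)),
        abs_of_nonneg (sub_nonneg.2 (hCm u v hu.1 h))]
      exact hLC u v hu.1 h
    · rw [Real.dist_eq, Real.dist_eq,
        abs_of_nonneg (sub_nonneg.2 (hLmono v u hv.1 h)),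
        abs_of_nonneg (sub_nonneg.2 (hCm v u hv.1 h))]
      exact hLC v u hv.1 h
  -- While the queue is nonempty, `w` is below its running maximum, which is therefore locally
  -- constant: no service is wasted.
  have hLd0 : ∀ t, 0 < t → w t < L t → deriv L t = 0 := by
    intro t ht hlt
    obtain ⟨m, hm1, hm2⟩ := exists_between hlt
    have hnhds : Icc 0 (t + 1) ∈ nhds t := Icc_mem_nhds ht (by linarith)
    have hLcont : ContinuousAt L t := by
      have := (hLac (t + 1) (by linarith)).continuousOn
      rw [uIcc_of_le (by linarith)] at this
      exact this.continuousAt hnhds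
    have hwcont : ContinuousAt w t := (hwc (t + 1) (by linarith)).continuousAt hnhds
    have hev : ∀ᶠ u in nhds t, w u < m ∧ m < L u ∧ 0 < u :=
      (hwcont.eventually_lt_const hm1).and ((hLcont.eventually_const_lt hm2).and (lt_mem_nhds ht))
    obtain ⟨l, u, htlu, hsub⟩ := mem_nhds_iff_exists_Ioo_subset.1 hev
    have hconst : ∀ p q, p ∈ Ioo l u → q ∈ Ioo l u → p ≤ q → L q = L p := by
      intro p q hp hq hpq
      refine le_antisymm ?_ (hLmono p q (hsub hp).2.2.le hpq)
      obtain ⟨s, hs, h⟩ := hLmax q (hsub hq).2.2.le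
      rcases le_total s p with hsp | hps
      · exact h ▸ hLle p s ⟨hs.1, hsp⟩
      · have h1 := (hsub (show s ∈ Ioo l u from ⟨hp.1.trans_le hps, hs.2.trans_lt hq.2⟩)).1
        have h2 := (hsub hq).2.1
        linarith
    have : L =ᶠ[nhds t] fun _ => L t := by
      filter_upwards [Ioo_mem_nhds htlu.1 htlu.2] with v hv
      rcases le_total v t with h | h
      · exact (hconst v t hv htlu h).symm
      · exact hconst t v htlu hv h
    rw [this.deriv_eq, deriv_const]
  have hdiff : ∀ᵐ t, 0 < t → DifferentiableAt ℝ L t ∧ HasDerivAt A (a t) t ∧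
      HasDerivAt C (c t) t := by
    have key : ∀ n : ℕ, ∀ᵐ t, t ∈ Icc (0 : ℝ) n → DifferentiableAt ℝ L t ∧ HasDerivAt A (a t) t ∧
        HasDerivAt C (c t) t := by
      intro n
      have hn : (0 : ℝ) ≤ n := n.cast_nonneg
      filter_upwards [(hLac n hn).ae_differentiableAt, (ha n hn).ae_hasDerivAt_integral,
        (hc n hn).ae_hasDerivAt_integral] with t h1 h2 h3 ht
      rw [uIcc_of_le hn] at h1 h2 h3
      exact ⟨h1 ht, h2 ht 0 (left_mem_Icc.2 hn), h3 ht 0 (left_mem_Icc.2 hn)⟩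
    filter_upwards [ae_all_iff.2 key] with t ht ht0
    obtain ⟨n, hn⟩ := exists_nat_ge t
    exact ht n ⟨ht0.le, hn⟩
  have hne : ∀ᵐ t : ℝ, t ≠ 0 := by simp [ae_iff, measure_singleton]
  set b : ℝ → ℝ := fun t => if t < 0 then 0 else c t - deriv L t with hb
  have hbpos : ∀ t, 0 ≤ t → b t = c t - deriv L t := fun t ht => if_neg (not_lt.2 ht)
  have hLI : ∀ t, 0 ≤ t → IntervalIntegrable (deriv L) volume 0 t := fun t ht =>
    (hLac t ht).intervalIntegrable_deriv
  refine ⟨fun t => L t - w t, b, ⟨ha, ?_, ?_, ?_, ?_⟩, fun t ht => if_pos ht⟩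
  · intro t ht
    refine ((hc t ht).sub (hLI t ht)).congr ?_
    intro u hu
    rw [uIoc_of_le ht] at hu
    exact (hbpos u hu.1.le).symm
  · intro t ht
    have : ∫ s in (0 : ℝ)..t, (a s - b s) = ∫ s in (0 : ℝ)..t, ((a s - c s) + deriv L s) := by
      refine intervalIntegral.integral_congr ?_
      intro u hu
      rw [uIcc_of_le ht] at hu
      simp only [hbpos u hu.1]
      ring
    rw [this, intervalIntegral.integral_add ((ha t ht).sub (hc t ht)) (hLI t ht),
      intervalIntegral.integral_sub (ha t ht) (hc t ht), (hLac t ht).integral_deriv_eq_sub,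
      hL0, hw0]
    simp only [hw, hAdef, hCdef]
    ring
  · intro t ht
    exact sub_nonneg.2 (hLle t t ⟨ht, le_rfl⟩)
  · filter_upwards [hdiff, hne, ha0] with t ht htne hat ht0
    have htpos : 0 < t := lt_of_le_of_ne ht0 (Ne.symm htne)
    obtain ⟨hd1, hd2, hd3⟩ := ht htpos
    have h0x : w t ≤ L t := hLle t t ⟨ht0, le_rfl⟩
    rw [hbpos t ht0]
    rcases h0x.lt_or_eq with hlt | heq
    · rw [hLd0 t htpos hlt, sub_zero]
      exact ⟨fun _ => rfl, hc0 t ht0, le_rfl⟩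
    -- An empty queue is at a minimum of its length, so `L' = c - a` and `b = a ≥ 0`; monotonicity
    -- of `L` gives `b ≤ c`.
    · have hmin : IsLocalMin (fun t => L t - (C t - A t)) t := by
        filter_upwards [lt_mem_nhds htpos] with u hu
        have h1 := hLle u u ⟨hu.le, le_rfl⟩
        simp only [hw] at h1 heq
        linarith
      have hder := hmin.hasDerivAt_eq_zero (hd1.hasDerivAt.sub (hd3.sub hd2))
      have hLnn : 0 ≤ deriv L t :=
        (hd1.hasDerivAt.hasDerivWithinAt (s := Ici t)).nonneg_of_monotoneOn
          (uniqueDiffWithinAt_Ici t).accPt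
          fun u hu v _ huv => hLmono u v (ht0.trans hu) huv
      refine ⟨fun h => absurd h (by linarith), ?_, ?_⟩
      · linarith [hat ht0]
      · linarith

end IsFluidQueue

/-! ### From network trajectories to single queues. -/

namespace QueueNetwork

variable {ι : Type*} [Fintype ι] {N : QueueNetwork ι} {x b x' b' : ι → ℝ → ℝ} {T : ℝ}

lemma delay_le_maxDelay (N : QueueNetwork ι) (i j : ι) : N.τ i j ≤ N.maxDelay :=
  le_ciSup (f := fun p : ι × ι => N.τ p.1 p.2) (finite_range _).bddAbove (i, j)

lemma maxDelay_nonneg (N : QueueNetwork ι) : 0 ≤ N.maxDelay :=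
  Real.iSup_nonneg fun p => (N.τ_pos p.1 p.2).le

/-- If every route has bounded length, then there is no infinite sequence of queues each of which
is fed by the next one. -/
lemma VisitsAtMost.wellFounded {K : ℕ} (hK : N.VisitsAtMost K) :
    WellFounded fun j i => 0 < N.r j i := by
  rw [wellFounded_iff_isEmpty_descending_chain]
  refine ⟨fun ⟨f, hf⟩ => ?_⟩
  -- An infinite chain runs upstream; its first `K + 1` queues, reversed, form a route that is too
  -- long.
  have h := hK (List.ofFn fun k : Fin (K + 1) => f k).reverse (by
    rw [List.isChain_reverse, List.isChain_iff_getElem]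
    intro k hk
    simpa [-List.ofFn_succ] using hf k)
  simp at h

lemma ae_sub_right {p : ℝ → Prop} (h : ∀ᵐ t, p t) (a : ℝ) : ∀ᵐ t, p (t - a) :=
  (measurePreserving_sub_right volume a).quasiMeasurePreserving.ae h

lemma ae_add_right {p : ℝ → Prop} (h : ∀ᵐ t, p t) (a : ℝ) : ∀ᵐ t, p (t + a) :=
  (measurePreserving_add_right volume a).quasiMeasurePreserving.ae h

lemma intervalIntegrable_delayed {f : ℝ → ℝ} {D a t : ℝ} (ha : 0 ≤ a) (haD : a ≤ D)
    (hf : ∀ t, 0 ≤ t → IntegrableOn f (Icc (-D) t)) (ht : 0 ≤ t) :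
    IntervalIntegrable (fun s => f (s - a)) volume 0 t := by
  have h : IntervalIntegrable f volume (0 - a) (t - a) := by
    rw [intervalIntegrable_iff_integrableOn_Icc_of_le (by linarith)]
    exact (hf t ht).mono_set (Icc_subset_Icc (by linarith) (by linarith))
  simpa using h.comp_sub_right a

lemma integrableOn_of_past_eq_zero {f : ℝ → ℝ} {D t : ℝ}
    (hf : ∀ t, 0 ≤ t → IntervalIntegrable f volume 0 t) (h0 : ∀ t < 0, f t = 0) (ht : 0 ≤ t) :
    IntegrableOn f (Icc (-D) t) := by
  have h1 : IntegrableOn f (Iio 0) :=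
    integrableOn_zero.congr_fun (fun t ht => (h0 t ht).symm) measurableSet_Iio
  have h2 := (intervalIntegrable_iff_integrableOn_Icc_of_le ht).1 (hf t ht)
  refine (h1.union h2).mono_set fun u hu => ?_
  rcases lt_or_ge u 0 with h | h
  · exact Or.inl h
  · exact Or.inr ⟨h, hu.2⟩

/-- Only queues `j` with `0 < N.r j i` are constrained, here and in the next two lemmas, so that
these apply inside inductions where only the feeders of `i` are under control. -/
lemma arrival_intervalIntegrable {i : ι}
    (hb : ∀ j, 0 < N.r j i → ∀ t, 0 ≤ t → IntegrableOn (b j) (Icc (-N.maxDelay) t)) {t : ℝ}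
    (ht : 0 ≤ t) : IntervalIntegrable (N.arrival b i) volume 0 t := by
  refine IntervalIntegrable.add
    ((intervalIntegrable_iff_integrableOn_Icc_of_le ht).2 (N.e_integrable i t ht)) ?_
  rw [← Finset.sum_fn]
  refine IntervalIntegrable.sum _ fun j _ => ?_
  rcases (N.r_nonneg j i).eq_or_lt with h | h
  · simp [← h]
  · exact (intervalIntegrable_delayed (N.τ_pos j i).le (N.delay_le_maxDelay j i) (hb j h)
      ht).mul_const _

lemma arrival_nonneg {i : ι} (hb : ∀ j, 0 < N.r j i → ∀ᵐ s, -N.maxDelay ≤ s → 0 ≤ b j s) :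
    ∀ᵐ t, 0 ≤ t → 0 ≤ N.arrival b i t := by
  have h : ∀ j, ∀ᵐ t, 0 ≤ t → 0 ≤ b j (t - N.τ j i) * N.r j i := by
    intro j
    rcases (N.r_nonneg j i).eq_or_lt with h | h
    · simp [← h]
    · filter_upwards [ae_sub_right (hb j h) (N.τ j i)] with t ht ht0
      exact mul_nonneg (ht (by linarith [N.delay_le_maxDelay j i])) h.le
  filter_upwards [ae_all_iff.2 h] with t ht ht0
  exact add_nonneg (N.e_nonneg i t ht0) (Finset.sum_nonneg fun j _ => ht j ht0)

lemma arrival_congr {i : ι} {s : ℝ} (hb : ∀ j, 0 < N.r j i → ∀ᵐ t, s ≤ t → b j t = b' j t) :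
    ∀ᵐ t, s + N.maxDelay ≤ t → N.arrival b i t = N.arrival b' i t := by
  have h : ∀ j, ∀ᵐ t, s + N.maxDelay ≤ t →
      b j (t - N.τ j i) * N.r j i = b' j (t - N.τ j i) * N.r j i := by
    intro j
    rcases (N.r_nonneg j i).eq_or_lt with h | h
    · simp [← h]
    · filter_upwards [ae_sub_right (hb j h) (N.τ j i)] with t ht ht0
      rw [ht (by linarith [N.delay_le_maxDelay j i])]
  filter_upwards [ae_all_iff.2 h] with t ht ht0
  simp only [arrival, Finset.sum_congr rfl fun j _ => ht j ht0]

namespace IsTrajectory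

lemma departure_nonneg (h : N.IsTrajectory x b) (i : ι) :
    ∀ᵐ s, -N.maxDelay ≤ s → 0 ≤ b i s := by
  filter_upwards [h.past_nonneg i, h.service i] with s h1 h2 hs
  rcases le_total s 0 with h0 | h0
  · exact h1 ⟨hs, h0⟩
  · obtain ⟨h3, h4, h5⟩ := h2 h0
    rcases lt_trichotomy (x i s) 0 with hx | hx | hx
    · exact (h5 hx).ge
    · exact (h4 hx).1
    · exact (h3 hx).symm ▸ N.c_nonneg i s h0

lemma intervalIntegrable_departure (h : N.IsTrajectory x b) (i : ι) {t : ℝ} (ht : 0 ≤ t) :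
    IntervalIntegrable (b i) volume 0 t :=
  (intervalIntegrable_iff_integrableOn_Icc_of_le ht).2
    ((h.integrable i t ht).mono_set (Icc_subset_Icc_left (by linarith [N.maxDelay_nonneg])))

lemma intervalIntegrable_arrival (h : N.IsTrajectory x b) (i : ι) {t : ℝ} (ht : 0 ≤ t) :
    IntervalIntegrable (N.arrival b i) volume 0 t :=
  arrival_intervalIntegrable (fun j _ => h.integrable j) ht

/-- A negative queue would have no departures and nonnegative arrivals, so `-x i` cannot rise above
zero. -/
lemma length_nonneg (h : N.IsTrajectory x b) (i : ι) {t : ℝ} (ht : 0 ≤ t) : 0 ≤ x i t := by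
  have hI : ∀ u, 0 ≤ u → IntervalIntegrable (fun s => N.arrival b i s - b i s) volume 0 u :=
    fun u hu => (h.intervalIntegrable_arrival i hu).sub (h.intervalIntegrable_departure i hu)
  have key := nonpos_of_rate_nonpos_of_pos (f := fun t => -x i t) ht (hI t ht).neg ?_ ?_
    (neg_nonpos.2 (h.init_nonneg i))
  · exact neg_nonpos.1 key
  · intro u hu
    have := h.balance i u hu.1
    simp only [Pi.neg_apply, intervalIntegral.integral_neg]
    linarith
  · filter_upwards [arrival_nonneg (i := i) fun j _ => h.departure_nonneg j, h.service i]
      with u h1 h2 hu hpos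
    have h3 := (h2 hu.1).2.2 (neg_pos.1 hpos)
    simpa [h3] using h1 hu.1

lemma isFluidQueue (h : N.IsTrajectory x b) (i : ι) :
    IsFluidQueue (N.arrival b i) (N.c i) (x i) (b i) where
  arrival_integrable _ := h.intervalIntegrable_arrival i
  departure_integrable _ := h.intervalIntegrable_departure i
  balance := h.balance i
  nonneg _ := h.length_nonneg i
  service := by
    filter_upwards [h.service i] with t ht ht0
    obtain ⟨h1, h2, -⟩ := ht ht0
    refine ⟨h1, ?_⟩
    rcases (h.length_nonneg i ht0).eq_or_lt with hx | hx
    · exact h2 hx.symm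
    · rw [h1 hx]
      exact ⟨N.c_nonneg i t ht0, le_rfl⟩

lemma of_isFluidQueue (hq : ∀ i, IsFluidQueue (N.arrival b i) (N.c i) (x i) (b i))
    (hpast : ∀ i, ∀ t < 0, b i t = 0) : N.IsTrajectory x b where
  init_nonneg i := (hq i).nonneg 0 le_rfl
  past_nonneg i := by
    have hne : ∀ᵐ t : ℝ, t ≠ 0 := by simp [ae_iff, measure_singleton]
    filter_upwards [hne] with t ht htI
    exact (hpast i t (lt_of_le_of_ne htI.2 ht)).ge
  integrable i t ht := integrableOn_of_past_eq_zero (hq i).departure_integrable (hpast i) ht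
  balance i := (hq i).balance
  service i := by
    filter_upwards [(hq i).service] with t ht ht0
    exact ⟨(ht ht0).1, fun _ => (ht ht0).2, fun hx => absurd hx ((hq i).nonneg t ht0).not_gt⟩

end IsTrajectory

/-! ### Periodic means and the traffic equations. -/

lemma PeriodicData.nat_mul (h : N.PeriodicData T) (hT : 0 ≤ T) (n : ℕ) :
    N.PeriodicData (n * T) := by
  induction n with
  | zero => intro i t _; simp
  | succ n ih =>
    intro i t ht
    have h1 := ih i t ht
    have h2 := h i (t + n * T) (by positivity)
    have : t + ((n + 1 : ℕ) : ℝ) * T = t + n * T + T := by push_cast; ring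
    rw [this]
    exact ⟨h2.1.trans h1.1, h2.2.trans h1.2⟩

lemma integral_nat_mul_period {f : ℝ → ℝ} (hT : 0 < T)
    (hf : ∀ t, 0 ≤ t → IntervalIntegrable f volume 0 t)
    (hper : ∀ n : ℕ, ∀ t, 0 ≤ t → f (t + n * T) = f t) (n : ℕ) :
    ∫ s in (0 : ℝ)..n * T, f s = n * T * ((1 / T) * ∫ s in (0 : ℝ)..T, f s) := by
  induction n with
  | zero => simp
  | succ n ih =>
    have h0 : (0 : ℝ) ≤ n * T := by positivity
    have h1 : ((n + 1 : ℕ) : ℝ) * T = T + n * T := by push_cast; ring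
    have h2 : ∫ s in n * T..T + n * T, f s = ∫ s in (0 : ℝ)..T, f s := by
      have := intervalIntegral.integral_comp_add_right (a := 0) (b := T) f (n * T)
      rw [zero_add] at this
      rw [← this]
      refine intervalIntegral.integral_congr fun s hs => ?_
      rw [uIcc_of_le hT.le] at hs
      exact hper n s hs.1
    rw [h1, ← intervalIntegral.integral_add_adjacent_intervals (hf _ h0)
      ((hf _ h0).symm.trans (hf _ (by positivity))), ih, h2]
    field_simp
    ring

lemma PeriodicData.integral_e (h : N.PeriodicData T) (hT : 0 < T) (i : ι) (n : ℕ) :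
    ∫ s in (0 : ℝ)..n * T, N.e i s = n * T * mean T N.e i :=
  integral_nat_mul_period hT
    (fun t ht => (intervalIntegrable_iff_integrableOn_Icc_of_le ht).2 (N.e_integrable i t ht))
    (fun n t ht => (h.nat_mul hT.le n i t ht).1) n

lemma PeriodicData.integral_c (h : N.PeriodicData T) (hT : 0 < T) (i : ι) (n : ℕ) :
    ∫ s in (0 : ℝ)..n * T, N.c i s = n * T * mean T N.c i :=
  integral_nat_mul_period hT
    (fun t ht => (intervalIntegrable_iff_integrableOn_Icc_of_le ht).2 (N.c_integrable i t ht))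
    (fun n t ht => (h.nat_mul hT.le n i t ht).2) n

/-- In an acyclic network, `(I - Rᵀ)⁻¹ v` solves the traffic equations with inflow `v`. -/
lemma traffic_equation [DecidableEq ι] (hwf : WellFounded fun j i => 0 < N.r j i) (v : ι → ℝ)
    (i : ι) : ((1 - N.routing.transpose)⁻¹.mulVec v) i =
      v i + ∑ j, ((1 - N.routing.transpose)⁻¹.mulVec v) j * N.r j i := by
  have happ : ∀ w : ι → ℝ, ∀ i,
      ((1 - N.routing.transpose).mulVec w) i = w i - ∑ j, w j * N.r j i := by
    intro w i
    rw [Matrix.sub_mulVec, Matrix.one_mulVec]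
    simp [Matrix.mulVec, dotProduct, routing, mul_comm]
  -- A kernel vector vanishes at `i` once it vanishes at all feeders of `i`.
  have hunit : IsUnit (1 - N.routing.transpose) := by
    rw [← Matrix.mulVec_injective_iff_isUnit]
    refine (injective_iff_map_eq_zero (1 - N.routing.transpose).mulVecLin).2 fun w hw => ?_
    funext i
    induction i using hwf.induction with
    | _ i ih =>
      have h := congrFun hw i
      rw [Matrix.mulVecLin_apply, happ] at h
      have h0 : ∑ j, w j * N.r j i = 0 := by
        refine Finset.sum_eq_zero fun j _ => ?_
        rcases (N.r_nonneg j i).eq_or_lt with hr | hr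
        · rw [← hr, mul_zero]
        · rw [ih j hr, Pi.zero_apply, zero_mul]
      rw [h0, sub_zero] at h
      exact h
  have h := happ ((1 - N.routing.transpose)⁻¹.mulVec v) i
  rw [Matrix.mulVec_mulVec, Matrix.mul_nonsing_inv _ ((Matrix.isUnit_iff_isUnit_det _).1 hunit),
    Matrix.one_mulVec] at h
  linarith

/-! ### Arrival bounds, emptying and coalescence in the network. -/

namespace IsTrajectory

/-- Vehicles joining queue `i` from `j` during `[0, t]` left `j` within `[-N.maxDelay, t]`; the part
before time `0` is a constant independent of `t`. -/
lemma integral_delayed_le (h : N.IsTrajectory x b) (i j : ι) {t : ℝ} (ht : 0 ≤ t) :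
    ∫ s in (0 : ℝ)..t, b j (s - N.τ j i) ≤
      (∫ s in (-N.maxDelay)..0, b j s) + ∫ s in (0 : ℝ)..t, b j s := by
  have hD := N.maxDelay_nonneg
  have hτ := N.τ_pos j i
  have hτD := N.delay_le_maxDelay j i
  have hI : IntervalIntegrable (b j) volume (-N.maxDelay) t :=
    (intervalIntegrable_iff_integrableOn_Icc_of_le (by linarith)).2 (h.integrable j t ht)
  have hI0 : IntervalIntegrable (b j) volume (-N.maxDelay) 0 :=
    (intervalIntegrable_iff_integrableOn_Icc_of_le (by linarith)).2 (h.integrable j 0 le_rfl)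
  rw [intervalIntegral.integral_add_adjacent_intervals hI0 (h.intervalIntegrable_departure j ht),
    intervalIntegral.integral_comp_sub_right]
  refine intervalIntegral.integral_mono_interval (by linarith) (by linarith) (by linarith) ?_ hI
  rw [Filter.EventuallyLE, ae_restrict_iff' measurableSet_Ioc]
  filter_upwards [h.departure_nonneg j] with s hs hsI using hs hsI.1.le

/-- Up to a constant, the total arrivals at each queue are bounded by the solution `lam` of the
traffic equations. -/
lemma exists_integral_arrival_le (h : N.IsTrajectory x b) (hT : 0 < T) (hper : N.PeriodicData T)
    (hwf : WellFounded fun j i => 0 < N.r j i) {lam : ι → ℝ}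
    (hlam : ∀ i, lam i = mean T N.e i + ∑ j, lam j * N.r j i) (i : ι) :
    ∃ C, ∀ n : ℕ, ∫ s in (0 : ℝ)..n * T, N.arrival b i s ≤ n * T * lam i + C := by
  induction i using hwf.induction with
  | _ i ih =>
    have hj : ∀ j, ∃ C, ∀ n : ℕ, ∫ s in (0 : ℝ)..n * T, b j (s - N.τ j i) * N.r j i ≤
        n * T * (lam j * N.r j i) + C := by
      intro j
      rcases (N.r_nonneg j i).eq_or_lt with hr | hr
      · exact ⟨0, fun n => by simp [← hr]⟩
      · obtain ⟨C, hC⟩ := ih j hr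
        -- The excess consists of vehicles initially in transit or queued at `j`, plus the excess of
        -- arrivals at `j`.
        refine ⟨((∫ s in (-N.maxDelay)..0, b j s) + x j 0 + C) * N.r j i, fun n => ?_⟩
        have hn : 0 ≤ n * T := by positivity
        have h1 := h.integral_delayed_le i j hn
        have h2 := (h.isFluidQueue j).integral_departure_le hn
        have h3 := hC n
        rw [intervalIntegral.integral_mul_const]
        calc _ ≤ ((∫ s in (-N.maxDelay)..0, b j s) + x j 0 + C + n * T * lam j) * N.r j i :=
              mul_le_mul_of_nonneg_right (by linarith) hr.le
          _ = _ := by ring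
    choose C hC using hj
    refine ⟨∑ j, C j, fun n => ?_⟩
    have hn : 0 ≤ n * T := by positivity
    have hd : ∀ j, IntervalIntegrable (fun s => b j (s - N.τ j i) * N.r j i) volume 0 (n * T) :=
      fun j => (intervalIntegrable_delayed (N.τ_pos j i).le (N.delay_le_maxDelay j i)
        (h.integrable j) hn).mul_const _
    have hsum : IntervalIntegrable (fun s => ∑ j, b j (s - N.τ j i) * N.r j i) volume 0
        (n * T) := by
      rw [← Finset.sum_fn]
      exact IntervalIntegrable.sum _ fun j _ => hd j
    simp only [arrival]
    rw [intervalIntegral.integral_add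
      ((intervalIntegrable_iff_integrableOn_Icc_of_le hn).2 (N.e_integrable i _ hn)) hsum,
      intervalIntegral.integral_finsetSum fun j _ => hd j, hper.integral_e hT, hlam i, mul_add,
      Finset.mul_sum, add_assoc, ← Finset.sum_add_distrib]
    gcongr with j
    exact hC j n

/-- In a stable network, every queue becomes empty again and again. -/
lemma exists_length_eq_zero [DecidableEq ι] (h : N.IsTrajectory x b) (hT : 0 < T)
    (hper : N.PeriodicData T) (hwf : WellFounded fun j i => 0 < N.r j i) (hstab : N.Stable T)
    (i : ι) {s : ℝ} (hs : 0 ≤ s) : ∃ t, s ≤ t ∧ x i t = 0 := by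
  obtain ⟨ε, hε, hlt⟩ := hstab
  obtain ⟨C, hC⟩ := h.exists_integral_arrival_le hT hper hwf (traffic_equation hwf _) i
  exact (h.isFluidQueue i).exists_eq_zero hT hC (hper.integral_c hT i)
    (fun t ht => (intervalIntegrable_iff_integrableOn_Icc_of_le ht).2 (N.c_integrable i t ht))
    (by linarith [hlt i]) hs

/-- In a stable network, any two trajectories eventually have the same state. -/
theorem exists_sameState [DecidableEq ι] (h : N.IsTrajectory x b) (h' : N.IsTrajectory x' b')
    (hT : 0 < T) (hper : N.PeriodicData T) (hwf : WellFounded fun j i => 0 < N.r j i)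
    (hstab : N.Stable T) : ∃ t₀ : ℝ, 0 ≤ t₀ ∧ ∀ t, t₀ ≤ t → N.SameState x b x' b' t := by
  have key : ∀ i, ∃ t₀ : ℝ, 0 ≤ t₀ ∧ (∀ t, t₀ ≤ t → x i t = x' i t) ∧
      ∀ᵐ t, t₀ ≤ t → b i t = b' i t := by
    intro i
    induction i using hwf.induction with
    | _ i ih =>
      have hup : ∀ j, ∃ t₀ : ℝ, 0 < N.r j i → ∀ᵐ t, t₀ ≤ t → b j t = b' j t := by
        intro j
        by_cases hr : 0 < N.r j i
        · obtain ⟨t₀, -, -, ht⟩ := ih j hr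
          exact ⟨t₀, fun _ => ht⟩
        · exact ⟨0, fun h => absurd h hr⟩
      choose s hs using hup
      obtain ⟨m, hm⟩ := (finite_range s).bddAbove
      have hsm : ∀ j, s j ≤ max m 0 := fun j => (hm (mem_range_self j)).trans (le_max_left _ _)
      -- The feeders agree from `max m 0` on; one maximal delay later the arrivals at `i` agree too.
      have h0 : 0 ≤ max m 0 + N.maxDelay := add_nonneg (le_max_right _ _) N.maxDelay_nonneg
      exact (h.isFluidQueue i).coalesce (h'.isFluidQueue i) h0
        (arrival_congr fun j hr => (hs j hr).mono fun t ht hmt => ht ((hsm j).trans hmt))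
        (h.exists_length_eq_zero hT hper hwf hstab i h0)
        (h'.exists_length_eq_zero hT hper hwf hstab i h0)
  choose s hs0 hsx hsb using key
  obtain ⟨m, hm⟩ := (finite_range s).bddAbove
  have hsm : ∀ i, s i ≤ max m 0 := fun i => (hm (mem_range_self i)).trans (le_max_left _ _)
  have hD := N.maxDelay_nonneg
  refine ⟨max m 0 + N.maxDelay, add_nonneg (le_max_right _ _) hD,
    fun t ht i => ⟨hsx i t (by linarith [hsm i]), ?_⟩⟩
  filter_upwards [hsb i] with u hu huI using hu (by linarith [hsm i, huI.1])

/-- A trajectory observed from time `P` on, where `P` is a period of the data, is a trajectory. -/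
lemma shift (h : N.IsTrajectory x b) {P : ℝ} (hP : 0 ≤ P) (hper : N.PeriodicData P) :
    N.IsTrajectory (fun i t => x i (t + P)) fun i t => b i (t + P) where
  init_nonneg i := by simpa using h.length_nonneg i hP
  past_nonneg i := by
    filter_upwards [ae_add_right (h.departure_nonneg i) P] with s hs hsI
    exact hs (by linarith [hsI.1])
  integrable i t ht := by
    have hD := N.maxDelay_nonneg
    have h1 : IntervalIntegrable (b i) volume (-N.maxDelay + P) (t + P) := by
      rw [intervalIntegrable_iff_integrableOn_Icc_of_le (by linarith)]
      exact (h.integrable i (t + P) (by linarith)).mono_set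
        (Icc_subset_Icc_left (by linarith))
    rw [← intervalIntegrable_iff_integrableOn_Icc_of_le (by linarith)]
    simpa using h1.comp_add_right P
  balance i t ht := by
    have h1 := (h.isFluidQueue i).balance_from hP (add_nonneg ht hP)
    have h2 : ∫ s in (0 : ℝ)..t, (N.arrival (fun i t => b i (t + P)) i s - b i (s + P)) =
        ∫ s in (0 : ℝ)..t, (N.arrival b i (s + P) - b i (s + P)) := by
      refine intervalIntegral.integral_congr fun s hs => ?_
      rw [uIcc_of_le ht] at hs
      simp only [arrival, (hper i s hs.1).1, sub_add_eq_add_sub]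
    rw [h2, intervalIntegral.integral_comp_add_right fun s => N.arrival b i s - b i s]
    simpa using h1
  service i := by
    filter_upwards [ae_add_right (h.service i) P] with t ht ht0
    rw [← (hper i t ht0).2]
    exact ht (add_nonneg ht0 hP)

end IsTrajectory

/-! ### Existence of a trajectory. -/

/-- An acyclic network has a trajectory. -/
theorem exists_isTrajectory (hwf : WellFounded fun j i => 0 < N.r j i) :
    ∃ x b : ι → ℝ → ℝ, N.IsTrajectory x b := by
  classical
  -- Total in `a`, with junk value `0`, so that the recursion need carry no proofs; `key` shows that
  -- the junk value never occurs.
  let out : ι → (ℝ → ℝ) → (ℝ → ℝ) × (ℝ → ℝ) := fun i a =>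
    if h : ∃ p : (ℝ → ℝ) × (ℝ → ℝ), IsFluidQueue a (N.c i) p.1 p.2 ∧ ∀ t < 0, p.2 t = 0 then
      h.choose else 0
  let b : ι → ℝ → ℝ := hwf.fix fun i rec => (out i fun t =>
    N.e i t + ∑ j, if h : 0 < N.r j i then rec j h (t - N.τ j i) * N.r j i else 0).2
  have hb : ∀ i, b i = (out i (N.arrival b i)).2 := by
    intro i
    have h1 : b i = (out i fun t =>
        N.e i t + ∑ j, if 0 < N.r j i then b j (t - N.τ j i) * N.r j i else 0).2 :=
      hwf.fix_eq _ i
    have h2 : (fun t => N.e i t + ∑ j, if 0 < N.r j i then b j (t - N.τ j i) * N.r j i else 0) =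
        N.arrival b i := by
      funext t
      refine congrArg (N.e i t + ·) (Finset.sum_congr rfl fun j _ => ?_)
      rcases (N.r_nonneg j i).eq_or_lt with h | h
      · simp [← h]
      · exact if_pos h
    rw [h2] at h1
    exact h1
  have key : ∀ i, IsFluidQueue (N.arrival b i) (N.c i) (out i (N.arrival b i)).1 (b i) ∧
      ∀ t < 0, b i t = 0 := by
    intro i
    induction i using hwf.induction with
    | _ i ih =>
      have hex : ∃ p : (ℝ → ℝ) × (ℝ → ℝ),
          IsFluidQueue (N.arrival b i) (N.c i) p.1 p.2 ∧ ∀ t < 0, p.2 t = 0 := by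
        obtain ⟨y, d, hyd⟩ := IsFluidQueue.exists_of_arrival (a := N.arrival b i) (c := N.c i)
          (fun t ht => arrival_intervalIntegrable (fun j hr t ht => integrableOn_of_past_eq_zero
            (ih j hr).1.departure_integrable (ih j hr).2 ht) ht)
          (fun t ht => (intervalIntegrable_iff_integrableOn_Icc_of_le ht).2
            (N.c_integrable i t ht))
          (arrival_nonneg fun j hr => (ih j hr).1.service.mono fun s hs _ => by
            rcases lt_or_ge s 0 with h | h
            · exact ((ih j hr).2 s h).ge
            · exact (hs h).2.1)
          (N.c_nonneg i)
        exact ⟨(y, d), hyd⟩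
      have hout : out i (N.arrival b i) = hex.choose := dif_pos hex
      have hspec := hex.choose_spec
      rw [← hout, ← hb i] at hspec
      exact hspec
  exact ⟨_, b, IsTrajectory.of_isFluidQueue (fun i => (key i).1) fun i => (key i).2⟩

/-! ### Periodic states and the conclusion. -/

namespace SameState

variable {x'' b'' : ι → ℝ → ℝ} {t : ℝ}

lemma symm (h : N.SameState x b x' b' t) : N.SameState x' b' x b t := fun i =>
  ⟨(h i).1.symm, (h i).2.mono fun _ hs hsI => (hs hsI).symm⟩

lemma trans (h : N.SameState x b x' b' t) (h' : N.SameState x' b' x'' b'' t) :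
    N.SameState x b x'' b'' t := fun i =>
  ⟨(h i).1.trans (h' i).1, by
    filter_upwards [(h i).2, (h' i).2] with s h1 h2 hsI using (h1 hsI).trans (h2 hsI)⟩

lemma shift {P : ℝ} (h : N.SameState x b x' b' (t + P)) :
    N.SameState (fun i s => x i (s + P)) (fun i s => b i (s + P)) (fun i s => x' i (s + P))
      (fun i s => b' i (s + P)) t := fun i =>
  ⟨(h i).1, by
    filter_upwards [ae_add_right (h i).2 P] with s hs hsI
    exact hs ⟨by linarith [hsI.1], by linarith [hsI.2]⟩⟩

end SameState

lemma IsPeriodicTrajectory.sameState_nat_mul (h : N.IsPeriodicTrajectory T x b) (hT : 0 ≤ T)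
    (n : ℕ) {t : ℝ} (ht : 0 ≤ t) :
    N.SameState (fun i s => x i (s + n * T)) (fun i s => b i (s + n * T)) x b t := by
  induction n with
  | zero => intro i; simp
  | succ n ih =>
    have h1 := (h.2 (t + n * T) (by positivity)).shift
    have h2 : ∀ s : ℝ, s + ((n + 1 : ℕ) : ℝ) * T = s + n * T + T := fun s => by push_cast; ring
    simp only [h2]
    exact h1.trans ih

end QueueNetwork

theorem theorem5 {ι : Type*} [Fintype ι] [DecidableEq ι] (N : QueueNetwork ι) (T : ℝ) (hT : 0 < T)
    (hper : N.PeriodicData T) (hstab : N.Stable T) (K : ℕ) (hK : N.VisitsAtMost K) :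
    ∃ xs bs : ι → ℝ → ℝ, N.IsPeriodicTrajectory T xs bs ∧
      (∀ x b : ι → ℝ → ℝ, N.IsPeriodicTrajectory T x b →
        ∀ t, 0 ≤ t → N.SameState x b xs bs t) ∧
      (∀ x b : ι → ℝ → ℝ, N.IsTrajectory x b →
        ∃ t₀ : ℝ, 0 ≤ t₀ ∧ ∀ t, t₀ ≤ t → N.SameState x b xs bs t) := by
  have hwf := hK.wellFounded
  have hmeet : ∀ {x b x' b'}, N.IsTrajectory x b → N.IsTrajectory x' b' →
      ∃ t₀ : ℝ, 0 ≤ t₀ ∧ ∀ t, t₀ ≤ t → N.SameState x b x' b' t :=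
    fun h h' => h.exists_sameState h' hT hper hwf hstab
  have hlarge : ∀ t₀ : ℝ, ∃ n : ℕ, t₀ ≤ n * T := fun t₀ => by
    obtain ⟨n, hn⟩ := exists_nat_ge (t₀ / T)
    exact ⟨n, (div_le_iff₀ hT).1 hn⟩
  obtain ⟨x, b, h⟩ := N.exists_isTrajectory hwf
  -- Coalescence of a trajectory with its own shift makes its state `T`-periodic after `t₀`.
  obtain ⟨t₀, -, ht₀⟩ := hmeet (h.shift hT.le hper) h
  obtain ⟨n, hn⟩ := hlarge t₀
  have hs : N.IsPeriodicTrajectory T (fun i t => x i (t + n * T)) fun i t => b i (t + n * T) := by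
    refine ⟨h.shift (by positivity) (hper.nat_mul hT.le n), fun t ht => ?_⟩
    have h1 := (ht₀ (t + n * T) (by linarith)).shift
    simp only [add_right_comm _ ((n : ℝ) * T) T] at h1
    exact h1
  refine ⟨_, _, hs, fun y d hy t ht => ?_, fun y d hy => hmeet hy hs.1⟩
  -- Two periodic trajectories agree late; periodicity carries the agreement at `t + m * T` back to
  -- `t`.
  obtain ⟨t₁, -, ht₁⟩ := hmeet hy.1 hs.1
  obtain ⟨m, hm⟩ := hlarge t₁
  exact ((hy.sameState_nat_mul hT.le m ht).symm.trans
    (ht₁ (t + m * T) (by linarith)).shift).trans (hs.sameState_nat_mul hT.le m ht)
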